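/- Let $p$ be an odd prime, $G$ a finite group and $P \in \mathrm{Syl}_p(G)$. Suppose that $G$ is $p$-stable, i.e. whenever $Q$ is a $p$-subgroup of $G$ and $g \in N_G(Q)$ satisfies $[Q,g,g]=1$, the coset $gC_G(Q)$ lies in $O_p(N_G(Q)/C_G(Q))$. Suppose also that $C_G(O_p(G)) \le O_p(G)$, and let $D \le P$ be a subgroup that is strongly closed in $P$ with respect to $G$, i.e. for all $U \subseteq D$ and $g \in G$ with $U^g \subseteq P$ one has $U^g \subseteq D$. For a finite $p$-group $K$ let $\Omega(K) = \langle x \in K \mid x^p = 1\rangle$, and let $J_o(K)$, $J_r(K)$ and $J_e(K)$ be the subgroups of $K$ generated, respectively, by all abelian subgroups of $K$ of maximum order, by all abelian subgroups of $K$ of maximum rank (the rank being the minimum number of generators), and by all elementary abelian subgroups of $K$ of maximum order. If the exponent of $\Omega(D)$ is $p$, then $Z(J_o(\Omega(D)))$, $Z(J_r(\Omega(D)))$ and $Z(J_e(\Omega(D)))$ are normal subgroups of $G$. Moreover $J_o(\Omega(D)) = J_r(\Omega(D)) = J_e(\Omega(D))$. -/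

import Mathlib

namespace ZJ

open scoped commutatorElement

variable {G : Type*} [Group G]

/-- `O_p(G)`: the subgroup generated by all normal `p`-subgroups of `G`
(for finite `G`, the largest normal `p`-subgroup). -/
def pCore (p : ℕ) (G : Type*) [Group G] : Subgroup G :=
  sSup {N : Subgroup G | N.Normal ∧ IsPGroup p N}

/-- `C_G(Q)` regarded as a subgroup of `N_G(Q)`. -/
def centralizerInNormalizer (Q : Subgroup G) :
    Subgroup (Subgroup.normalizer (Q : Set G)) :=
  (Subgroup.centralizer (Q : Set G)).subgroupOf (Subgroup.normalizer (Q : Set G))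

instance centralizerInNormalizer_normal (Q : Subgroup G) :
    (centralizerInNormalizer Q).Normal := by
  constructor
  rintro ⟨c, hc⟩ h ⟨g, hg⟩
  simp only [centralizerInNormalizer, Subgroup.mem_subgroupOf] at h ⊢
  have hg' := inv_mem hg
  rw [Subgroup.mem_centralizer_iff] at h ⊢
  intro x hx
  have h1 : g⁻¹ * x * g ∈ (Q : Set G) := by
    have := (Subgroup.mem_normalizer_iff.1 hg' x).1 hx
    simpa using this
  have h2 := h _ h1
  change x * (g * c * g⁻¹) = g * c * g⁻¹ * x
  calc x * (g * c * g⁻¹) = g * (g⁻¹ * x * g * c) * g⁻¹ := by group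
    _ = g * (c * (g⁻¹ * x * g)) * g⁻¹ := by rw [h2]
    _ = g * c * g⁻¹ * x := by group

/-- `G` is `p`-stable: whenever `Q` is a `p`-subgroup of `G` and `g ∈ N_G(Q)` satisfies
`[Q, g, g] = 1`, the coset `g C_G(Q)` lies in `O_p(N_G(Q) / C_G(Q))`. -/
def IsPStable (p : ℕ) (G : Type*) [Group G] : Prop :=
  ∀ Q : Subgroup G, IsPGroup p Q →
    ∀ g : Subgroup.normalizer (Q : Set G),
      (∀ x ∈ Q, ⁅⁅x, (g : G)⁆, (g : G)⁆ = 1) →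
        (QuotientGroup.mk g : Subgroup.normalizer (Q : Set G) ⧸ centralizerInNormalizer Q) ∈
          pCore p (Subgroup.normalizer (Q : Set G) ⧸ centralizerInNormalizer Q)

/-- `D` is strongly closed in `P` with respect to `G`: `D` is a nonempty subset of `P`, and
whenever `U ⊆ D`, `g ∈ G` and `U ^ g = g⁻¹ U g ⊆ P`, also `U ^ g ⊆ D`. -/
def IsStronglyClosed (D P : Set G) : Prop :=
  D.Nonempty ∧ D ⊆ P ∧
    ∀ U : Set G, U ⊆ D → ∀ g : G,
      (fun u => g⁻¹ * u * g) '' U ⊆ P → (fun u => g⁻¹ * u * g) '' U ⊆ D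

/-- `Ω(K) = ⟨x ∈ K | x ^ p = 1⟩`. -/
def Omega (p : ℕ) (K : Subgroup G) : Subgroup G :=
  Subgroup.closure {x : G | x ∈ K ∧ x ^ p = 1}

/-- An elementary abelian `p`-subgroup. -/
def IsElemAbelian (p : ℕ) (A : Subgroup G) : Prop :=
  IsMulCommutative A ∧ ∀ a ∈ A, a ^ p = 1

/-- `𝒜_o(P)`: the abelian subgroups of `P` of maximum order. -/
def maxOrderAbelian (P : Subgroup G) : Set (Subgroup G) :=
  {A | A ≤ P ∧ IsMulCommutative A ∧
    ∀ B : Subgroup G, B ≤ P → IsMulCommutative B → Nat.card B ≤ Nat.card A}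

/-- `𝒜_r(P)`: the abelian subgroups of `P` of maximum rank
(the rank is the minimum number of generators). -/
def maxRankAbelian [Finite G] (P : Subgroup G) : Set (Subgroup G) :=
  {A | A ≤ P ∧ IsMulCommutative A ∧
    ∀ B : Subgroup G, B ≤ P → IsMulCommutative B → Group.rank B ≤ Group.rank A}

/-- `𝒜_e(P)`: the elementary abelian subgroups of `P` of maximum order. -/
def maxOrderElemAbelian (p : ℕ) (P : Subgroup G) : Set (Subgroup G) :=
  {A | A ≤ P ∧ IsElemAbelian p A ∧
    ∀ B : Subgroup G, B ≤ P → IsElemAbelian p B → Nat.card B ≤ Nat.card A}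

/-- The Thompson subgroup `J_o(P)`. -/
def Jo (P : Subgroup G) : Subgroup G := sSup (maxOrderAbelian P)

/-- The Thompson subgroup `J_r(P)`. -/
def Jr [Finite G] (P : Subgroup G) : Subgroup G := sSup (maxRankAbelian P)

/-- The Thompson subgroup `J_e(P)`. -/
def Je (p : ℕ) (P : Subgroup G) : Subgroup G := sSup (maxOrderElemAbelian p P)

/-- The center `Z(H)` of a subgroup `H` of `G`, as a subgroup of `G`. -/
def centerOf (H : Subgroup G) : Subgroup G := (Subgroup.center H).map H.subtype

end ZJ

/-! ### Centres and abelian subgroups of maximum order. -/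

namespace ZJ

open scoped commutatorElement

variable {G : Type*} [Group G]

/-! In `Omega p D`, of exponent p, every abelian subgroup is elementary abelian of order p^rank, so
the three families coincide. `Omega p D` is again strongly closed, so all reduces to
`centerOf_Jo_normal`: Z = Z(J_o(D)) is normal for D strongly closed.

There Z is abelian and normal in P, so it acts quadratically on O_p(G); p-stability and C_G(O_p(G))
≤ O_p(G) give Z ≤ O_p(G). It remains to see that Z ∩ B is normal for each normal p-subgroup B, by
induction on |B|. The critical case is that B is the normal closure of Z ∩ B, which forces [B,B] ≤ Z
∩ Z(B). Let L be the normal core of N(Z ∩ B). By p-stability, A ≤ L for every abelian A ≤ D of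
maximum order normalized by B. If all such maximal A lie in L, then J_o(D) = J_o(D ∩ L) and the
Frattini argument finishes. Otherwise take A not in L with |A ∩ B| maximal: `exists_replacement`
gives A' ≤ L normalizing A, and A' ≤ L forces B ≤ A', so B normalizes A, a contradiction. -/

theorem mem_centerOf {H : Subgroup G} {z : G} :
    z ∈ centerOf H ↔ z ∈ H ∧ ∀ y ∈ H, y * z = z * y := by
  constructor
  · rintro ⟨⟨z, hz⟩, hc, rfl⟩
    refine ⟨hz, fun y hy => ?_⟩
    exact congrArg Subtype.val (Subgroup.mem_center_iff.1 hc ⟨y, hy⟩)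
  · rintro ⟨hz, hc⟩
    exact ⟨⟨z, hz⟩, Subgroup.mem_center_iff.2 fun y => Subtype.ext (hc y y.2), rfl⟩

theorem le_normalizer_of_conj_mem {N H : Subgroup G}
    (h : ∀ g ∈ N, ∀ x ∈ H, g * x * g⁻¹ ∈ H) : N ≤ Subgroup.normalizer (H : Set G) := by
  intro g hg
  refine Subgroup.mem_normalizer_iff.2 fun x => ⟨h g hg x, fun hx => ?_⟩
  simpa [mul_assoc] using h g⁻¹ (inv_mem hg) _ hx

theorem conj_mem_of_mem_normalizer {H : Subgroup G} {g x : G}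
    (hg : g ∈ Subgroup.normalizer (H : Set G)) (hx : x ∈ H) : g * x * g⁻¹ ∈ H :=
  (Subgroup.mem_normalizer_iff.1 hg x).1 hx

theorem normalizer_le_normalizer_centerOf (H : Subgroup G) :
    Subgroup.normalizer (H : Set G) ≤ Subgroup.normalizer (centerOf H : Set G) := by
  refine le_normalizer_of_conj_mem fun g hg x hx => ?_
  rw [mem_centerOf] at hx ⊢
  refine ⟨conj_mem_of_mem_normalizer hg hx.1, fun y hy => ?_⟩
  have h := hx.2 _ (conj_mem_of_mem_normalizer (inv_mem hg) hy)
  calc y * (g * x * g⁻¹) = g * (g⁻¹ * y * g⁻¹⁻¹ * x) * g⁻¹ := by group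
    _ = g * (x * (g⁻¹ * y * g⁻¹⁻¹)) * g⁻¹ := by rw [h]
    _ = g * x * g⁻¹ * y := by group

theorem normalizer_le_normalizer_Jo (H : Subgroup G) :
    Subgroup.normalizer (H : Set G) ≤ Subgroup.normalizer (Jo H : Set G) := by
  refine le_normalizer_of_conj_mem fun g hg => ?_
  suffices Jo H ≤ (Jo H).comap (MulAut.conj g).toMonoidHom from fun x hx => this hx
  refine sSup_le fun A hA => ?_
  rw [← Subgroup.map_le_iff_le_comap]
  refine le_sSup ⟨?_, ?_, ?_⟩
  · rintro _ ⟨a, ha, rfl⟩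
    exact conj_mem_of_mem_normalizer hg (hA.1 ha)
  · have := hA.2.1
    infer_instance
  · intro B hB hB'
    rw [Nat.card_congr (A.equivMapOfInjective _ (MulAut.conj g).injective).toEquiv.symm]
    exact hA.2.2 B hB hB'

theorem Jo_le (D : Subgroup G) : Jo D ≤ D := sSup_le fun _ hA => hA.1

/-- An abelian subgroup of maximum order lying in an intermediate subgroup has maximum order
there, and the two families are nested. -/
theorem maxOrderAbelian_subset {A D E : Subgroup G} (hED : E ≤ D) (hA : A ∈ maxOrderAbelian D)
    (hAE : A ≤ E) : A ∈ maxOrderAbelian E ∧ maxOrderAbelian E ⊆ maxOrderAbelian D :=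
  ⟨⟨hAE, hA.2.1, fun B hB => hA.2.2 B (hB.trans hED)⟩, fun _ hB =>
    ⟨hB.1.trans hED, hB.2.1, fun C hC hC' => (hA.2.2 C hC hC').trans (hB.2.2 A hAE hA.2.1)⟩⟩

section Finite

variable [Finite G]

theorem maxOrderAbelian.mem_of_commute {A D : Subgroup G} (hA : A ∈ maxOrderAbelian D) {z : G}
    (hz : z ∈ D) (hc : ∀ a ∈ A, a * z = z * a) : z ∈ A := by
  have := hA.2.1
  have hcomm : IsMulCommutative (Subgroup.closure ((A : Set G) ∪ {z})) := by
    refine Subgroup.isMulCommutative_closure ?_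
    rintro x (hx | rfl) y (hy | rfl)
    · exact setLike_mul_comm hx hy
    · exact hc x hx
    · exact (hc y hy).symm
    · rfl
  have hle : A ≤ Subgroup.closure ((A : Set G) ∪ {z}) := fun a ha =>
    Subgroup.subset_closure (Or.inl ha)
  have hD : Subgroup.closure ((A : Set G) ∪ {z}) ≤ D := by
    rw [Subgroup.closure_le]
    rintro x (hx | rfl)
    · exact hA.1 hx
    · exact hz
  rw [Subgroup.eq_of_le_of_card_ge hle (hA.2.2 _ hD hcomm)]
  exact Subgroup.subset_closure (Or.inr rfl)

theorem centerOf_Jo_le {A D : Subgroup G} (hA : A ∈ maxOrderAbelian D) : centerOf (Jo D) ≤ A := by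
  intro z hz
  rw [mem_centerOf] at hz
  exact maxOrderAbelian.mem_of_commute hA (Jo_le D hz.1) fun a ha => hz.2 a (le_sSup hA ha)

theorem maxOrderAbelian_nonempty (D : Subgroup G) : (maxOrderAbelian D).Nonempty := by
  obtain ⟨A, hA, hmax⟩ := Set.exists_max_image {A : Subgroup G | A ≤ D ∧ IsMulCommutative A}
    (fun A => Nat.card A) (Set.toFinite _) ⟨⊥, bot_le, inferInstance⟩
  exact ⟨A, hA.1, hA.2, fun B hB hB' => hmax B ⟨hB, hB'⟩⟩

end Finite

/-! ### Commutator calculus and the replacement theorem. -/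

theorem commutator_mul_left {u v w : G} (h : Commute u ⁅v, w⁆) :
    ⁅u * v, w⁆ = ⁅v, w⁆ * ⁅u, w⁆ := by
  calc ⁅u * v, w⁆ = u * ⁅v, w⁆ * (w * u⁻¹ * w⁻¹) := by
        simp only [commutatorElement_def]; group
    _ = _ := by rw [h.eq]; simp only [commutatorElement_def]; group

theorem commutator_mul_right {u v w : G} (h : Commute v ⁅u, w⁆) :
    ⁅u, v * w⁆ = ⁅u, v⁆ * ⁅u, w⁆ := by
  calc ⁅u, v * w⁆ = ⁅u, v⁆ * (v * ⁅u, w⁆) * v⁻¹ := by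
        simp only [commutatorElement_def]; group
    _ = _ := by rw [h.eq]; group

theorem commutator_mul_conj (a b x : G) : ⁅a * b, x⁆ = a * ⁅b, x⁆ * a⁻¹ * ⁅a, x⁆ := by
  simp only [commutatorElement_def]; group

section ClassTwo

variable {A B : Subgroup G}
  (hAB : A ≤ Subgroup.normalizer (B : Set G))
  (hcB : ∀ u ∈ B, ∀ v ∈ B, ∀ t ∈ B, Commute t ⁅u, v⁆)
  (hcA : ∀ u ∈ B, ∀ v ∈ B, ∀ t ∈ A, Commute t ⁅u, v⁆)

include hAB in
theorem commutator_mem_of_normalizes {a x : G} (ha : a ∈ A) (hx : x ∈ B) : ⁅a, x⁆ ∈ B := by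
  rw [commutatorElement_def]
  exact mul_mem (conj_mem_of_mem_normalizer (hAB ha) hx) (inv_mem hx)

include hAB hcB hcA in
/-- If `A` centralizes `⁅B, B⁆`, then `⁅A, B⁆` centralizes the fixed points of `A` on `B`. -/
theorem commutator_commutator_eq_one {a u w : G} (ha : a ∈ A) (hu : u ∈ B) (hw : w ∈ B)
    (haw : Commute a w) : ⁅⁅a, u⁆, w⁆ = 1 := by
  have hm := commutator_mem_of_normalizes hAB ha hu
  have h1 : a * ⁅u, w⁆ * a⁻¹ = ⁅u, w⁆ := by
    rw [(hcA u hu w hw a ha).eq]; group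
  have h2 : a * ⁅u, w⁆ * a⁻¹ = ⁅⁅a, u⁆ * u, w⁆ := by
    rw [conjugate_commutatorElement, haw.eq]
    simp only [commutatorElement_def]; group
  rw [commutator_mul_left (hcB u hu w hw _ hm), h1] at h2
  exact mul_eq_left.1 h2.symm

include hAB hcB hcA in
-- Conjugation by `a` fixes `⁅x, ⁅b, x⁆⁆`; expand the conjugate bilinearly. The term `⁅⁅a, x⁆, ⁅a,
-- ⁅b, x⁆⁆⁆` dies because its second entry commutes with `a`.
theorem commutator_commutator_inv_eq [IsMulCommutative A] {a b x : G} (ha : a ∈ A) (hb : b ∈ A)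
    (hx : x ∈ B) (hw : ⁅a, ⁅b, x⁆⁆ ∈ A) : ⁅⁅a, x⁆, ⁅b, x⁆⁆ * ⁅x, ⁅a, ⁅b, x⁆⁆⁆ = 1 := by
  have hma := commutator_mem_of_normalizes hAB ha hx
  have hmb := commutator_mem_of_normalizes hAB hb hx
  have hwB := commutator_mem_of_normalizes hAB ha hmb
  have h1 : a * ⁅x, ⁅b, x⁆⁆ * a⁻¹ = ⁅x, ⁅b, x⁆⁆ := by
    rw [(hcA x hx _ hmb a ha).eq]; group
  have h2 : a * ⁅x, ⁅b, x⁆⁆ * a⁻¹ = ⁅⁅a, x⁆ * x, ⁅a, ⁅b, x⁆⁆ * ⁅b, x⁆⁆ := by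
    rw [conjugate_commutatorElement]
    simp only [commutatorElement_def]; group
  have h3 := commutator_commutator_eq_one hAB hcB hcA ha hx hwB
    (setLike_mul_comm ha hw)
  rw [h1, commutator_mul_left (hcB _ hx _ (mul_mem hwB hmb) _ hma),
    commutator_mul_right (hcB _ hx _ hmb _ hwB), commutator_mul_right (hcB _ hma _ hmb _ hwB),
    h3, one_mul, (hcB x hx _ hwB _ (commutator_mem_of_normalizes
      (B.le_normalizer) hx hmb)).symm.eq, mul_assoc] at h2
  have h4 := mul_eq_left.1 h2.symm
  rwa [(hcB x hx _ hwB _ (commutator_mem_of_normalizes B.le_normalizer hma hmb)).eq]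

include hAB hcB hcA in
-- Expanding `⁅a * b, x⁆ = ⁅b * a, x⁆` and pairing with `x` shows that the second factor in
-- `commutator_commutator_inv_eq` is symmetric in `a` and `b`.
theorem commutator_commutator_symm [IsMulCommutative A] {a b x : G} (ha : a ∈ A) (hb : b ∈ A)
    (hx : x ∈ B) (hab : ⁅a, ⁅b, x⁆⁆ ∈ A) (hba : ⁅b, ⁅a, x⁆⁆ ∈ A) :
    ⁅⁅a, x⁆, ⁅b, x⁆⁆ = ⁅⁅b, x⁆, ⁅a, x⁆⁆ := by
  have hma := commutator_mem_of_normalizes hAB ha hx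
  have hmb := commutator_mem_of_normalizes hAB hb hx
  have hwab := commutator_mem_of_normalizes hAB ha hmb
  have hwba := commutator_mem_of_normalizes hAB hb hma
  have h1 := commutator_commutator_inv_eq hAB hcB hcA ha hb hx hab
  have h2 := commutator_commutator_inv_eq hAB hcB hcA hb ha hx hba
  suffices ⁅x, ⁅a, ⁅b, x⁆⁆⁆ = ⁅x, ⁅b, ⁅a, x⁆⁆⁆ by
    rw [this] at h1
    exact mul_right_cancel (h1.trans h2.symm)
  have e : ∀ a b : G, ⁅a * b, x⁆ = ⁅a, ⁅b, x⁆⁆ * (⁅b, x⁆ * ⁅a, x⁆) := by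
    intro a b
    simp only [commutatorElement_def]; group
  have h3 := e a b
  rw [setLike_mul_comm ha hb, e b a] at h3
  have h4 := congrArg (fun t => ⁅x, t⁆) h3
  rw [commutator_mul_right (hcB _ hx _ (mul_mem hma hmb) _ hwba),
    commutator_mul_right (hcB _ hx _ (mul_mem hmb hma) _ hwab),
    commutator_mul_right (hcB _ hx _ hmb _ hma), commutator_mul_right (hcB _ hx _ hma _ hmb),
    (hcB x hx _ hmb _ (commutator_mem_of_normalizes B.le_normalizer hx hma)).eq] at h4
  exact (mul_right_cancel h4).symm

end ClassTwo

/-- If `A` is abelian, then for any `x` the subgroup `M = ⟨⁅a, x⁆ | a ∈ A⟩` satisfies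
`|A| ≤ |C_A(M) M|`. -/
theorem card_le_card_commutator_sup [Finite G] (A : Subgroup G) [IsMulCommutative A] (x : G) :
    let S : Set G := {m | ∃ a ∈ A, m = ⁅a, x⁆}
    Nat.card A ≤ Nat.card
      ((A ⊓ Subgroup.centralizer S ⊔ Subgroup.closure S : Subgroup G) : Subgroup G) := by
  intro S
  set C := A ⊓ Subgroup.centralizer S
  set T := C ⊔ Subgroup.closure S
  have hCA : C ≤ A := inf_le_left
  have hCT : C ≤ T := le_sup_left
  have hS : ∀ a ∈ A, ⁅a, x⁆ ∈ T := fun a ha =>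
    (le_sup_right : _ ≤ T) (Subgroup.subset_closure ⟨a, ha, rfl⟩)
  -- This makes aC ↦ ⁅a, x⁆C an injection from A/C to T/C. Since ad = da, `⁅a, x⁆` determines how
  -- `a` conjugates `⁅d, x⁆`.
  have key : ∀ a ∈ A, ∀ b ∈ A, ⁅a, x⁆⁻¹ * ⁅b, x⁆ ∈ C → a⁻¹ * b ∈ C := by
    intro a ha b hb hc
    refine Subgroup.mem_inf.2 ⟨mul_mem (inv_mem ha) hb, ?_⟩
    rw [Subgroup.mem_centralizer_iff]
    rintro _ ⟨d, hd, rfl⟩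
    have conj : ∀ a ∈ A, a * ⁅d, x⁆ * a⁻¹ = d * ⁅a, x⁆ * d⁻¹ * ⁅d, x⁆ * ⁅a, x⁆⁻¹ := by
      intro a ha
      have h := commutator_mul_conj a d x
      rw [setLike_mul_comm ha hd, commutator_mul_conj d a x] at h
      rw [h]; group
    have h1 := conj a ha
    have h2 := conj b hb
    have hcd := setLike_mul_comm (s := A) hc.1 hd
    have hcm := Subgroup.mem_centralizer_iff.1 hc.2 _ ⟨d, hd, rfl⟩
    generalize hc' : ⁅a, x⁆⁻¹ * ⁅b, x⁆ = c at hcd hcm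
    have hb' : ⁅b, x⁆ = ⁅a, x⁆ * c := by rw [← hc']; group
    have h3 : b * ⁅d, x⁆ * b⁻¹ = a * ⁅d, x⁆ * a⁻¹ := by
      rw [h1, h2, hb']
      calc d * (⁅a, x⁆ * c) * d⁻¹ * ⁅d, x⁆ * (⁅a, x⁆ * c)⁻¹
          = d * ⁅a, x⁆ * d⁻¹ * (d * c) * d⁻¹ * (⁅d, x⁆ * c⁻¹) * ⁅a, x⁆⁻¹ := by group
        _ = d * ⁅a, x⁆ * d⁻¹ * (c * d) * d⁻¹ * (⁅d, x⁆ * c⁻¹) * ⁅a, x⁆⁻¹ := by rw [hcd]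
        _ = d * ⁅a, x⁆ * d⁻¹ * (c * ⁅d, x⁆) * c⁻¹ * ⁅a, x⁆⁻¹ := by group
        _ = _ := by rw [← hcm]; group
    calc ⁅d, x⁆ * (a⁻¹ * b) = a⁻¹ * (a * ⁅d, x⁆ * a⁻¹) * b := by group
      _ = _ := by rw [← h3]; group
  have hle : C.relIndex A ≤ C.relIndex T := by
    refine Nat.card_le_card_of_injective
      (fun q : A ⧸ C.subgroupOf A =>
        (QuotientGroup.mk ⟨⁅(q.out : G), x⁆, hS _ q.out.2⟩ : T ⧸ C.subgroupOf T)) ?_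
    intro q r h
    rw [QuotientGroup.eq] at h
    rw [← q.out_eq', ← r.out_eq', QuotientGroup.eq]
    exact key _ q.out.2 _ r.out.2 h
  rw [← Subgroup.relIndex_bot_left, ← Subgroup.relIndex_bot_left,
    ← Subgroup.relIndex_mul_relIndex ⊥ C A bot_le hCA,
    ← Subgroup.relIndex_mul_relIndex ⊥ C T bot_le hCT]
  exact Nat.mul_le_mul_left _ hle

/-- A subgroup `B` of a `p`-group normalized but not normalizing `A` contains an element outside
`N(A)` whose commutators with `A` normalize `A`. -/
theorem exists_commutator_mem_normalizer [Finite G] {p : ℕ} [Fact p.Prime] {D A B : Subgroup G}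
    (hD : IsPGroup p D) (hAD : A ≤ D) (hBD : B ≤ D)
    (hAB : A ≤ Subgroup.normalizer (B : Set G)) (hn : ¬ B ≤ Subgroup.normalizer (A : Set G)) :
    ∃ x ∈ B, x ∉ Subgroup.normalizer (A : Set G) ∧
      ∀ a ∈ A, ⁅a, x⁆ ∈ Subgroup.normalizer (A : Set G) := by
  set S : Subgroup G := A ⊔ B
  have hS : IsPGroup p S := hD.to_le (sup_le hAD hBD)
  have := hS.isNilpotent
  set T : Subgroup S := (Subgroup.normalizer (A : Set G)).subgroupOf S
  have hT : T < ⊤ := by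
    rw [lt_top_iff_ne_top]
    intro h
    exact hn (le_sup_right.trans (Subgroup.subgroupOf_eq_top.1 h))
  -- Normalizers grow in the nilpotent group AB: some y = ax normalizes N_{AB}(A) from outside it,
  -- and the factor `a` can be dropped.
  obtain ⟨⟨y, hyS⟩, hyN, hyT⟩ := SetLike.exists_of_lt
    (Group.normalizerCondition_of_isNilpotent T hT)
  obtain ⟨a, ha, x, hx, rfl⟩ : ∃ a ∈ A, ∃ x ∈ B, a * x = y := by
    have h : y ∈ ((A ⊔ B : Subgroup G) : Set G) := hyS
    rwa [Subgroup.coe_mul_of_left_le_normalizer_right A B hAB] at h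
  have hxS : x ∈ S := Subgroup.mem_sup_right hx
  have haT : (⟨a, Subgroup.mem_sup_left ha⟩ : S) ∈ T := A.le_normalizer ha
  have hxT : (⟨x, hxS⟩ : S) ∈ Subgroup.normalizer (T : Set S) := by
    have := mul_mem (inv_mem (T.le_normalizer haT)) hyN
    convert this using 1
    exact Subtype.ext (by simp)
  refine ⟨x, hx, fun h => hyT (mul_mem (A.le_normalizer ha) h), fun b hb => ?_⟩
  have hbT : (⟨b⁻¹, inv_mem (Subgroup.mem_sup_left hb)⟩ : S) ∈ T := inv_mem (A.le_normalizer hb)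
  have h : x * b⁻¹ * x⁻¹ ∈ Subgroup.normalizer (A : Set G) :=
    conj_mem_of_mem_normalizer (H := T) hxT hbT
  have h' := mul_mem (A.le_normalizer hb) h
  rw [commutatorElement_def]
  simpa only [mul_assoc] using h'

/-- Glauberman's replacement theorem. -/
theorem exists_replacement [Finite G] {p : ℕ} [Fact p.Prime] (hp : p ≠ 2) {D A B : Subgroup G}
    (hD : IsPGroup p D) (hA : A ∈ maxOrderAbelian D) (hBD : B ≤ D)
    (hAB : A ≤ Subgroup.normalizer (B : Set G))
    (hcB : ∀ u ∈ B, ∀ v ∈ B, ∀ t ∈ B, Commute t ⁅u, v⁆)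
    (hcA : ∀ u ∈ B, ∀ v ∈ B, ∀ t ∈ A, Commute t ⁅u, v⁆)
    (hn : ¬ B ≤ Subgroup.normalizer (A : Set G)) :
    ∃ A' ∈ maxOrderAbelian D, A ⊓ B < A' ⊓ B ∧ A' ≤ Subgroup.normalizer (A : Set G) := by
  have hcomm := hA.2.1
  obtain ⟨x, hx, hxA, hxN⟩ := exists_commutator_mem_normalizer hD hA.1 hBD hAB hn
  have hmB : ∀ a ∈ A, ⁅a, x⁆ ∈ B := fun a ha => commutator_mem_of_normalizes hAB ha hx
  have hmA : ∀ a ∈ A, ∀ b ∈ A, ⁅a, ⁅b, x⁆⁆ ∈ A := by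
    intro a ha b hb
    have h := conj_mem_of_mem_normalizer (hxN b hb) (inv_mem ha)
    have h' := mul_mem ha h
    rw [commutatorElement_def]
    simpa only [mul_assoc] using h'
  have hmm : ∀ a ∈ A, ∀ b ∈ A, ⁅a, x⁆ * ⁅b, x⁆ = ⁅b, x⁆ * ⁅a, x⁆ := by
    intro a ha b hb
    rw [← commutatorElement_eq_one_iff_mul_comm]
    -- The commutator is both symmetric and antisymmetric, so its square is 1; it is a p-element
    -- with p odd.
    have h1 := commutator_commutator_symm hAB hcB hcA ha hb hx (hmA a ha b hb) (hmA b hb a ha)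
    rw [← commutatorElement_inv ⁅a, x⁆] at h1
    have h2 : ⁅⁅a, x⁆, ⁅b, x⁆⁆ ^ 2 = 1 := by
      rw [pow_two]; nth_rewrite 1 [h1]; group
    have hmem : ⁅⁅a, x⁆, ⁅b, x⁆⁆ ∈ D := by
      have h1 := hBD (hmB a ha)
      have h2 := hBD (hmB b hb)
      exact mul_mem (mul_mem (mul_mem h1 h2) (inv_mem h1)) (inv_mem h2)
    obtain ⟨k, hk⟩ := hD ⟨_, hmem⟩
    have hk' : ⁅⁅a, x⁆, ⁅b, x⁆⁆ ^ p ^ k = 1 := congrArg Subtype.val hk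
    have hcop : Nat.Coprime 2 (p ^ k) :=
      Nat.Coprime.pow_right _ ((Nat.coprime_primes Nat.prime_two Fact.out).2 hp.symm)
    rw [← orderOf_eq_one_iff]
    exact Nat.eq_one_of_dvd_coprimes hcop (orderOf_dvd_of_pow_eq_one h2)
      (orderOf_dvd_of_pow_eq_one hk')
  set S : Set G := {m | ∃ a ∈ A, m = ⁅a, x⁆}
  have hSB : Subgroup.closure S ≤ B := by
    rw [Subgroup.closure_le]
    rintro _ ⟨a, ha, rfl⟩
    exact hmB a ha
  have hAS : A ⊓ B ≤ A ⊓ Subgroup.centralizer S := by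
    refine le_inf inf_le_left fun w hw => ?_
    rw [Subgroup.mem_centralizer_iff]
    rintro _ ⟨a, ha, rfl⟩
    rw [← commutatorElement_eq_one_iff_mul_comm]
    exact commutator_commutator_eq_one hAB hcB hcA ha hx hw.2 (setLike_mul_comm ha hw.1)
  have hcard := card_le_card_commutator_sup A x
  have habel : IsMulCommutative
      (A ⊓ Subgroup.centralizer S ⊔ Subgroup.closure S : Subgroup G) := by
    have : A ⊓ Subgroup.centralizer S ⊔ Subgroup.closure S = Subgroup.closure
        (((A ⊓ Subgroup.centralizer S : Subgroup G) : Set G) ∪ S) := by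
      rw [Subgroup.closure_union, Subgroup.closure_eq]
    rw [this]
    refine Subgroup.isMulCommutative_closure ?_
    rintro y (hy | hy) z (hz | hz)
    · exact setLike_mul_comm hy.1 hz.1
    · exact (Subgroup.mem_centralizer_iff.1 hy.2 z hz).symm
    · exact Subgroup.mem_centralizer_iff.1 hz.2 y hy
    · obtain ⟨a, ha, rfl⟩ := hy
      obtain ⟨b, hb, rfl⟩ := hz
      exact hmm a ha b hb
  refine ⟨A ⊓ Subgroup.centralizer S ⊔ Subgroup.closure S,
    ⟨sup_le (inf_le_left.trans hA.1) (hSB.trans hBD), habel, fun C hC hC' =>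
      (hA.2.2 C hC hC').trans hcard⟩, lt_of_le_of_ne ?_ ?_, sup_le ?_ ?_⟩
  · exact le_inf (hAS.trans le_sup_left) inf_le_right
  -- Equality would put every `⁅a, x⁆` in A, so `x` would normalize A.
  · intro h
    have hSA : ∀ a ∈ A, ⁅a, x⁆ ∈ A := by
      intro a ha
      have hm : ⁅a, x⁆ ∈ Subgroup.closure S := Subgroup.subset_closure ⟨a, ha, rfl⟩
      have : ⁅a, x⁆ ∈ A ⊓ B := h ▸ Subgroup.mem_inf.2 ⟨Subgroup.mem_sup_right hm, hSB hm⟩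
      exact this.1
    refine hxA (Subgroup.mem_normalizer_fintype fun a ha => ?_)
    have h := inv_mem (mul_mem (inv_mem ha) (hSA a ha))
    rw [commutatorElement_def] at h
    simpa [mul_assoc] using h
  · exact inf_le_left.trans A.le_normalizer
  · rw [Subgroup.closure_le]
    rintro _ ⟨a, ha, rfl⟩
    exact hxN a ha

end ZJ

/-! ### The p-core, p-stability and Sylow arguments. -/

namespace ZJ

open scoped commutatorElement

variable {G : Type*} [Group G] {p : ℕ}

theorem isPGroup_pCore (p : ℕ) [Fact p.Prime] (G : Type*) [Group G] [Finite G] :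
    IsPGroup p (pCore p G) :=
  (default : Sylow p G).isPGroup'.to_le <| sSup_le fun _ hN => by
    have := hN.1
    exact hN.2.le_sylow_of_normal _

instance pCore_normal (p : ℕ) (G : Type*) [Group G] : (pCore p G).Normal := by
  rw [← Subgroup.normalizer_eq_top_iff, eq_top_iff]
  refine le_normalizer_of_conj_mem fun g _ => ?_
  suffices pCore p G ≤ (pCore p G).comap (MulAut.conj g).toMonoidHom from fun x hx => this hx
  exact sSup_le fun N hN x hx => (le_sSup hN : N ≤ pCore p G) (hN.1.conj_mem x hx g)

theorem le_pCore {N : Subgroup G} (hN : N.Normal) (h : IsPGroup p N) : N ≤ pCore p G :=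
  le_sSup ⟨hN, h⟩

variable [Finite G]

/-- `p`-stability applied to a normal `p`-subgroup `B`: an element acting quadratically on `B` lies
in a normal subgroup which is a `p`-group modulo `C_G(B)`. -/
theorem IsPStable.exists_normal [Fact p.Prime] (hst : IsPStable p G) {B : Subgroup G}
    (hB : B.Normal) (hBp : IsPGroup p B) {g : G} (hg : ∀ x ∈ B, ⁅⁅x, g⁆, g⁆ = 1) :
    ∃ K : Subgroup G, K.Normal ∧ g ∈ K ∧
      ∀ k ∈ K, ∃ n : ℕ, k ^ p ^ n ∈ Subgroup.centralizer (B : Set G) := by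
  have hN : Subgroup.normalizer (B : Set G) = ⊤ := Subgroup.normalizer_eq_top_iff.2 hB
  have hmem : ∀ x : G, x ∈ Subgroup.normalizer (B : Set G) := fun x => hN ▸ Subgroup.mem_top x
  let f : G →* Subgroup.normalizer (B : Set G) ⧸ centralizerInNormalizer B :=
    (QuotientGroup.mk' _).comp ((MonoidHom.id G).codRestrict _ hmem)
  have hf : ∀ x, f x = 1 ↔ x ∈ Subgroup.centralizer (B : Set G) := fun x =>
    QuotientGroup.eq_one_iff (N := centralizerInNormalizer B) ⟨x, hmem x⟩
  refine ⟨(pCore p _).comap f, inferInstance, hst B hBp ⟨g, hmem g⟩ hg, fun k hk => ?_⟩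
  obtain ⟨n, hn⟩ := isPGroup_pCore p _ ⟨f k, hk⟩
  refine ⟨n, (hf _).1 ?_⟩
  rw [map_pow]
  exact congrArg Subtype.val hn

/-- |K : H ∩ K| = |HK : H|. For H Sylow, this makes H ∩ K Sylow in K. -/
theorem relIndex_dvd_index_of_normal_right (H K : Subgroup G) [K.Normal] :
    H.relIndex K ∣ H.index := by
  have h1 : (H ⊓ K).index = K.relIndex H * H.index := by
    rw [← Subgroup.inf_relIndex_left, Subgroup.relIndex_mul_index inf_le_left]
  have h2 : (H ⊓ K).index = H.relIndex K * K.index := by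
    rw [← Subgroup.inf_relIndex_right, Subgroup.relIndex_mul_index inf_le_right]
  have h3 : K.relIndex H * (H ⊔ K).index = K.index := by
    rw [← Subgroup.relIndex_sup_right, Subgroup.relIndex_mul_index le_sup_right]
  have h4 : K.relIndex H ≠ 0 := Subgroup.index_ne_zero_of_finite
  refine ⟨(H ⊔ K).index, Nat.eq_of_mul_eq_mul_left (Nat.pos_of_ne_zero h4) ?_⟩
  rw [← h1, h2, ← h3]
  ring

variable [Fact p.Prime]

theorem not_dvd_relIndex (P : Sylow p G) (K : Subgroup G) [K.Normal] :
    ¬ p ∣ (P : Subgroup G).relIndex K := fun h =>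
  P.not_dvd_index (h.trans (relIndex_dvd_index_of_normal_right _ _))

theorem normalizer_inf_sup_eq_top (P : Sylow p G) (K : Subgroup G) [K.Normal] :
    Subgroup.normalizer ((P ⊓ K : Subgroup G) : Set G) ⊔ K = ⊤ := by
  have h : IsPGroup p ((P : Subgroup G).subgroupOf K) :=
    P.isPGroup'.comap_of_injective _ K.subtype_injective
  have := (h.toSylow (not_dvd_relIndex P K)).normalizer_sup_eq_top
  have hS : (h.toSylow (not_dvd_relIndex P K) : Subgroup K) = (P : Subgroup G).subgroupOf K := rfl
  rwa [hS, Subgroup.subgroupOf_map_subtype] at this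

/-- If `K` is normal in `G` and is a `p`-group modulo the normal subgroup `C`, then every subgroup containing
`C` and a Sylow `p`-subgroup of `G` contains `K`. -/
theorem le_of_sylow_le (P : Sylow p G) {C K H : Subgroup G} [C.Normal] [K.Normal]
    (hK : ∀ k ∈ K, ∃ n : ℕ, k ^ p ^ n ∈ C) (hPH : P ≤ H) (hCH : C ≤ H) : K ≤ H := by
  have hq : IsPGroup p (K ⧸ C.subgroupOf K) := by
    intro q
    induction q using QuotientGroup.induction_on with
    | H k =>
      obtain ⟨n, hn⟩ := hK k k.2
      exact ⟨n, (QuotientGroup.eq_one_iff (k ^ p ^ n)).2 hn⟩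
  obtain ⟨n, hn⟩ := IsPGroup.iff_card.1 hq
  -- |K : H ∩ K| is a power of p because of C, and prime to p because of P.
  have h1 : H.relIndex K ∣ p ^ n := hn ▸ Subgroup.relIndex_dvd_of_le_left K hCH
  have h2 : H.relIndex K ∣ (P : Subgroup G).relIndex K := Subgroup.relIndex_dvd_of_le_left K hPH
  rw [← Subgroup.relIndex_eq_one]
  exact Nat.eq_one_of_dvd_coprimes
    (Nat.Prime.coprime_pow_of_not_dvd Fact.out (not_dvd_relIndex P K)) h2 h1

end ZJ

/-! ### Strongly closed subgroups and normality of the centres. -/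

namespace ZJ

open scoped commutatorElement

variable {G : Type*} [Group G]

namespace IsStronglyClosed

variable {D P : Subgroup G}

theorem le (hD : IsStronglyClosed (D : Set G) (P : Set G)) : D ≤ P := hD.2.1

theorem conj_mem (hD : IsStronglyClosed (D : Set G) (P : Set G)) {x : G} (hx : x ∈ D) (g : G)
    (h : g * x * g⁻¹ ∈ P) : g * x * g⁻¹ ∈ D := by
  have := hD.2.2 {x} (by simpa using hx) g⁻¹ (by simpa using h)
  simpa using this

theorem normalizer_inf_le (hD : IsStronglyClosed (D : Set G) (P : Set G)) (L : Subgroup G)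
    [L.Normal] : Subgroup.normalizer ((P ⊓ L : Subgroup G) : Set G) ≤
      Subgroup.normalizer ((D ⊓ L : Subgroup G) : Set G) := by
  refine le_normalizer_of_conj_mem fun g hg x hx => ?_
  have h := conj_mem_of_mem_normalizer hg (x := x) ⟨hD.le hx.1, hx.2⟩
  exact ⟨hD.conj_mem hx.1 g h.1, h.2⟩

theorem le_normalizer (hD : IsStronglyClosed (D : Set G) (P : Set G)) :
    P ≤ Subgroup.normalizer (D : Set G) :=
  le_normalizer_of_conj_mem fun g hg _ hx =>
    hD.conj_mem hx g (mul_mem (mul_mem hg (hD.le hx)) (inv_mem hg))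

end IsStronglyClosed

theorem normal_of_le_normalizer {H : Subgroup G} (h : ⊤ ≤ Subgroup.normalizer (H : Set G)) :
    H.Normal :=
  Subgroup.normalizer_eq_top_iff.1 (top_le_iff.1 h)

theorem commutator_commutator_of_le_normalizer {A B : Subgroup G} [IsMulCommutative A]
    (h : B ≤ Subgroup.normalizer (A : Set G)) {a x : G} (ha : a ∈ A) (hx : x ∈ B) :
    ⁅⁅x, a⁆, a⁆ = 1 :=
  commutatorElement_eq_one_iff_mul_comm.2
    (setLike_mul_comm (s := A) (commutator_mem_of_normalizes h hx ha) ha)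

theorem Je_eq_Jo {p : ℕ} {E : Subgroup G} (hE : ∀ x ∈ E, x ^ p = 1) : Je p E = Jo E := by
  suffices maxOrderElemAbelian p E = maxOrderAbelian E by rw [Je, this, Jo]
  ext A
  exact ⟨fun h => ⟨h.1, h.2.1.1, fun B hB hB' => h.2.2 B hB ⟨hB', fun b hb => hE b (hB hb)⟩⟩,
    fun h => ⟨h.1, ⟨h.2.1, fun a ha => hE a (h.1 ha)⟩, fun B hB hB' => h.2.2 B hB hB'.1⟩⟩

theorem Omega_le (p : ℕ) (D : Subgroup G) : Omega p D ≤ D :=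
  (Subgroup.closure_le _).2 fun _ hx => hx.1

/-- A conjugate in P of an element of `Omega p D` lies in D and has p-th power 1, so it is one of
the generators. -/
theorem IsStronglyClosed.omega {p : ℕ} {D P : Subgroup G} (hD : IsStronglyClosed (D : Set G) (P : Set G))
    (hE : ∀ x ∈ Omega p D, x ^ p = 1) :
    IsStronglyClosed (Omega p D : Set G) (P : Set G) := by
  refine ⟨⟨1, one_mem _⟩, (Omega_le p D).trans hD.le, ?_⟩
  rintro U hU g hg _ ⟨u, hu, rfl⟩
  have h := hg ⟨u, hu, rfl⟩
  have huD := Omega_le p D (hU hu)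
  have hD' := hD.conj_mem huD g⁻¹ (by simpa using h)
  refine Subgroup.subset_closure ⟨by simpa using hD', ?_⟩
  have := conj_pow (i := p) (a := g⁻¹) (b := u)
  rw [hE u (hU hu), inv_inv] at this
  simpa using this

variable [Finite G] {p : ℕ} [Fact p.Prime]

open scoped Pointwise in
/-- The intersection of `Z(J_o(D))` with the normal closure `B` of that intersection is normal,
provided it is so for `⁅B, B⁆`. -/
theorem centerOf_Jo_inf_normal_of_normalClosure (hp : p ≠ 2) (hst : IsPStable p G)
    (P : Sylow p G) {D : Subgroup G} (hD : IsStronglyClosed (D : Set G) (P : Set G))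
    {B : Subgroup G} [hB : B.Normal] (hBp : IsPGroup p B)
    (hcl : Subgroup.normalClosure ((centerOf (Jo D) ⊓ B : Subgroup G) : Set G) = B)
    (hB' : (centerOf (Jo D) ⊓ ⁅B, B⁆).Normal) : (centerOf (Jo D) ⊓ B).Normal := by
  set Z := centerOf (Jo D) with hZdef
  have hZD : Z ≤ D := fun z hz => Jo_le D (mem_centerOf.1 hz).1
  have hBP : B ≤ P := hBp.le_sylow_of_normal P
  have hNB : Subgroup.normalizer (B : Set G) = ⊤ := Subgroup.normalizer_eq_top_iff.2 hB
  have hDp : IsPGroup p D := P.isPGroup'.to_le hD.le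
  have hinf : ∀ {N Y : Subgroup G}, N ≤ Subgroup.normalizer (Y : Set G) →
      N ≤ Subgroup.normalizer ((Y ⊓ B : Subgroup G) : Set G) := fun hN =>
    le_normalizer_of_conj_mem fun g hg _ hx =>
      ⟨conj_mem_of_mem_normalizer (hN hg) hx.1, hB.conj_mem _ hx.2 g⟩
  have hZN : ∀ E : Subgroup G, Subgroup.normalizer (E : Set G) ≤
      Subgroup.normalizer ((centerOf (Jo E) ⊓ B : Subgroup G) : Set G) := fun E =>
    hinf ((normalizer_le_normalizer_Jo E).trans (normalizer_le_normalizer_centerOf _))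
  have hPN : P ≤ Subgroup.normalizer ((Z ⊓ B : Subgroup G) : Set G) :=
    hD.le_normalizer.trans (hZN D)
  have hBcl : ∀ {Y : Subgroup G}, Y ≤ B → (∀ z ∈ Z ⊓ B, ∀ g : G, g * z * g⁻¹ ∈ Y) → B ≤ Y := by
    intro Y _ h
    rw [← hcl, Subgroup.normalClosure, Subgroup.closure_le]
    intro x hx
    obtain ⟨z, hz, hzx⟩ := Group.mem_conjugatesOfSet_iff.1 hx
    obtain ⟨g, rfl⟩ := isConj_iff.1 hzx
    exact h z hz g
  have hBD : B ≤ D := (hBcl (Y := B ⊓ D) inf_le_left fun z hz g =>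
    have h := hB.conj_mem z hz.2 g
    ⟨h, hD.conj_mem (hZD hz.1) g (hBP h)⟩).trans inf_le_right
  -- Since B ≤ P normalizes Z ∩ B, it centralizes Z ∩ B modulo the normal subgroup Z ∩ [B,B]. The
  -- same holds for all conjugates of Z ∩ B, which generate B.
  have hcomm : ∀ u ∈ B, ∀ v ∈ B, ⁅u, v⁆ ∈ Z ⊓ ⁅B, B⁆ := by
    let π := QuotientGroup.mk' (Z ⊓ ⁅B, B⁆)
    have hπ : ∀ u v : G, π v * π u = π u * π v ↔ ⁅u, v⁆ ∈ Z ⊓ ⁅B, B⁆ := by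
      intro u v
      rw [← QuotientGroup.eq_one_iff (N := Z ⊓ ⁅B, B⁆) ⁅u, v⁆, eq_comm,
        ← commutatorElement_eq_one_iff_mul_comm, ← map_commutatorElement]
      rfl
    have hz : ∀ z ∈ Z ⊓ B, ∀ b ∈ B, ⁅z, b⁆ ∈ Z ⊓ ⁅B, B⁆ := by
      intro z hz b hb
      refine ⟨?_, Subgroup.commutator_mem_commutator hz.2 hb⟩
      have h := mul_mem hz (conj_mem_of_mem_normalizer (hPN (hBP hb)) (inv_mem hz))
      rw [commutatorElement_def]
      simpa only [mul_assoc] using h.1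
    have hle : B ≤ B ⊓ (Subgroup.centralizer (π '' B)).comap π := by
      refine hBcl inf_le_left fun z hzm g => ⟨hB.conj_mem z hzm.2 g, ?_⟩
      change π _ ∈ Subgroup.centralizer _
      rw [Subgroup.mem_centralizer_iff]
      rintro _ ⟨b, hb, rfl⟩
      rw [hπ]
      have h := hB'.conj_mem _ (hz z hzm _ (hB.conj_mem b hb g⁻¹)) g
      convert h using 1
      simp only [commutatorElement_def]
      group
    intro u hu v hv
    exact (hπ u v).1 (Subgroup.mem_centralizer_iff.1 (hle hu).2 _ ⟨v, hv, rfl⟩)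
  have hcZ : ⁅B, B⁆ ≤ Z := Subgroup.commutator_le.2 fun u hu v hv => (hcomm u hu v hv).1
  have hBc : B ≤ B ⊓ Subgroup.centralizer ((⁅B, B⁆ : Subgroup G) : Set G) := by
    refine hBcl inf_le_left fun z hz g =>
      ⟨hB.conj_mem z hz.2 g, Subgroup.Normal.conj_mem inferInstance z ?_ g⟩
    rw [Subgroup.mem_centralizer_iff]
    exact fun c hc => (mem_centerOf.1 hz.1).2 c (mem_centerOf.1 (hcZ hc)).1
  have hcB : ∀ u ∈ B, ∀ v ∈ B, ∀ t ∈ B, Commute t ⁅u, v⁆ := fun u hu v hv t ht =>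
    (Subgroup.mem_centralizer_iff.1 (hBc ht).2 _ (hcomm u hu v hv).2).symm
  set L := (Subgroup.normalizer ((Z ⊓ B : Subgroup G) : Set G)).normalCore
  have hLN : L ≤ Subgroup.normalizer ((Z ⊓ B : Subgroup G) : Set G) := Subgroup.normalCore_le _
  have hfrat := normalizer_inf_sup_eq_top P L
  have hNE := (hD.normalizer_inf_le L).trans (hZN (D ⊓ L))
  have hquad : ∀ A ∈ maxOrderAbelian D, B ≤ Subgroup.normalizer (A : Set G) → A ≤ L := by
    intro A hA hBA a ha
    have := hA.2.1
    obtain ⟨K, hKn, haK, hK⟩ := hst.exists_normal hB hBp fun x hx =>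
      commutator_commutator_of_le_normalizer hBA ha hx
    -- Both P and C_G(B) normalize Z ∩ B, hence so does K, which is a p-group modulo C_G(B).
    refine Subgroup.normal_le_normalCore.2 (le_of_sylow_le P hK hPN ?_) haK
    refine le_normalizer_of_conj_mem fun c hc x hx => ?_
    rw [← Subgroup.mem_centralizer_iff.1 hc x hx.2, mul_inv_cancel_right]
    exact hx
  have hBA : ∀ A ∈ maxOrderAbelian D, A ≤ L → B ≤ A := by
    intro A hA hAL
    obtain ⟨hAE, hsub⟩ := maxOrderAbelian_subset inf_le_left hA (le_inf hA.1 hAL)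
    have hZ' : Z ≤ centerOf (Jo (D ⊓ L)) := fun z hz => mem_centerOf.2
      ⟨le_sSup hAE (centerOf_Jo_le hA hz), fun y hy =>
        (mem_centerOf.1 hz).2 y (sSup_le_sSup hsub hy)⟩
    -- Write g = nl with n in N(P ∩ L) and l in L: `l` preserves Z ∩ B, and `n` preserves Z(J_o(D ∩
    -- L)) ∩ B, which contains it.
    refine (hBcl (Y := centerOf (Jo (D ⊓ L)) ⊓ B) inf_le_right fun z hz g => ?_).trans
      (inf_le_left.trans (centerOf_Jo_le hAE))
    obtain ⟨n, hn, l, hl, rfl⟩ : g ∈ ((Subgroup.normalizer ((P ⊓ L : Subgroup G) : Set G) : Set G)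
        * (L : Set G)) := by
      rw [← Subgroup.mul_normal, hfrat]
      trivial
    have h := conj_mem_of_mem_normalizer (hNE hn)
      (inf_le_inf_right B hZ' (conj_mem_of_mem_normalizer (hLN hl) hz))
    convert h using 1
    group
  by_cases hall : ∀ A ∈ maxOrderAbelian D, A ≤ L
  · have hJo : Jo (D ⊓ L) = Jo D := by
      obtain ⟨A, hA⟩ := maxOrderAbelian_nonempty D
      have h := fun A hA => maxOrderAbelian_subset inf_le_left hA (le_inf hA.1 (hall A hA))
      exact le_antisymm (sSup_le_sSup (h A hA).2) (sSup_le_sSup fun A hA => (h A hA).1)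
    refine normal_of_le_normalizer (hfrat ▸ sup_le ?_ hLN)
    rwa [hJo] at hNE
  · push Not at hall
    obtain ⟨A, ⟨hA, hAL⟩, hmax⟩ := Set.exists_max_image
      {A : Subgroup G | A ∈ maxOrderAbelian D ∧ ¬ A ≤ L}
      (fun A => Nat.card (A ⊓ B : Subgroup G)) (Set.toFinite _) hall
    have hn : ¬ B ≤ Subgroup.normalizer (A : Set G) := fun h => hAL (hquad A hA h)
    have := hA.2.1
    obtain ⟨A', hA', hlt, hle⟩ := exists_replacement hp hDp hA hBD (hNB ▸ le_top) hcB
      (fun u hu v hv t ht => setLike_mul_comm ht (centerOf_Jo_le hA (hcomm u hu v hv).1)) hn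
    have hA'L : A' ≤ L := by
      by_contra h
      exact hlt.ne (Subgroup.eq_of_le_of_card_ge hlt.le (hmax A' ⟨hA', h⟩))
    exact absurd ((hBA A' hA' hA'L).trans hle) hn

/-- Passing to the normal closure of Z ∩ B leaves the intersection with Z unchanged, so B may be
assumed to be that closure. Then [B,B] < B by nilpotency, and induction applies to [B,B]. -/
theorem centerOf_Jo_inf_normal (hp : p ≠ 2) (hst : IsPStable p G) (P : Sylow p G)
    {D : Subgroup G} (hD : IsStronglyClosed (D : Set G) (P : Set G)) (B : Subgroup G)
    (hB : B.Normal) (hBp : IsPGroup p B) : (centerOf (Jo D) ⊓ B).Normal := by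
  induction hn : Nat.card B using Nat.strong_induction_on generalizing B with
  | _ n ih =>
  have key : ∀ C : Subgroup G, C.Normal → C < B → (centerOf (Jo D) ⊓ C).Normal := by
    intro C hC hCB
    refine ih _ ?_ C hC (hBp.to_le hCB.le) rfl
    by_contra h
    exact hCB.ne (Subgroup.eq_of_le_of_card_ge hCB.le (hn ▸ not_lt.1 h))
  have hcl : Subgroup.normalClosure ((centerOf (Jo D) ⊓ B : Subgroup G) : Set G) ≤ B :=
    Subgroup.normalClosure_le_normal inf_le_right
  rcases hcl.eq_or_lt with h | h
  · rcases eq_or_ne B ⊥ with rfl | hbot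
    · rw [inf_bot_eq]
      infer_instance
    have := hBp.isNilpotent
    have hnt : Nontrivial B := (Subgroup.nontrivial_iff_ne_bot B).2 hbot
    refine centerOf_Jo_inf_normal_of_normalClosure hp hst P hD hBp h
      (key _ inferInstance ?_)
    have hlt : ⁅(⊤ : Subgroup B), (⊤ : Subgroup B)⁆ < ⊤ :=
      Group.IsSolvable.commutator_lt_top_of_nontrivial B
    have hmap := Subgroup.map_subtype_lt_map_subtype.2 hlt
    rwa [Subgroup.map_commutator, ← MonoidHom.range_eq_map, Subgroup.range_subtype] at hmap
  · have h' := key _ inferInstance h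
    suffices centerOf (Jo D) ⊓ Subgroup.normalClosure
        ((centerOf (Jo D) ⊓ B : Subgroup G) : Set G) = centerOf (Jo D) ⊓ B by rwa [this] at h'
    exact le_antisymm (inf_le_inf_left _ hcl)
      (le_inf inf_le_left Subgroup.le_normalClosure)

/-- Glauberman's `ZJ`-theorem for a strongly closed subgroup. -/
theorem centerOf_Jo_normal (hp : p ≠ 2) (hst : IsPStable p G) (P : Sylow p G)
    (hC : Subgroup.centralizer (pCore p G : Set G) ≤ pCore p G)
    {D : Subgroup G} (hD : IsStronglyClosed (D : Set G) (P : Set G)) :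
    (centerOf (Jo D)).Normal := by
  set Z := centerOf (Jo D)
  have hZP : Z ≤ P := fun z hz => hD.le (Jo_le D (mem_centerOf.1 hz).1)
  have hPN : P ≤ Subgroup.normalizer (Z : Set G) := hD.le_normalizer.trans
    ((normalizer_le_normalizer_Jo D).trans (normalizer_le_normalizer_centerOf _))
  have hOP : pCore p G ≤ P := (isPGroup_pCore p G).le_sylow_of_normal P
  have hcomm : IsMulCommutative Z := by
    refine .of_setLike_mul_comm fun a ha b hb => ?_
    exact (mem_centerOf.1 hb).2 a (mem_centerOf.1 ha).1
  have hZO : Z ≤ pCore p G := by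
    intro z hz
    obtain ⟨K, hK, hzK, hKC⟩ := hst.exists_normal (pCore_normal p G) (isPGroup_pCore p G)
      fun x hx => commutator_commutator_of_le_normalizer (hOP.trans hPN) hz hx
    refine le_pCore hK (fun ⟨k, hk⟩ => ?_) hzK
    obtain ⟨n, hn⟩ := hKC k hk
    obtain ⟨m, hm⟩ := isPGroup_pCore p G ⟨_, hC hn⟩
    refine ⟨n + m, Subtype.ext ?_⟩
    change k ^ p ^ (n + m) = 1
    rw [pow_add, pow_mul]
    exact congrArg Subtype.val hm
  have h := centerOf_Jo_inf_normal hp hst P hD _ (pCore_normal p G) (isPGroup_pCore p G)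
  rwa [inf_eq_left.2 hZO] at h

/-- The exponent bounds |A| by p^rank; conversely, an F_p-basis of A generates it, so the rank is at
most the dimension. -/
theorem card_eq_pow_rank {A : Type*} [Group A] [Finite A] (hc : ∀ a b : A, a * b = b * a)
    (h : ∀ a : A, a ^ p = 1) : Nat.card A = p ^ Group.rank A := by
  let : CommGroup A := { mul_comm := hc }
  refine le_antisymm (Nat.le_of_dvd (pow_pos (Nat.Prime.pos Fact.out) _)
    (card_dvd_exponent_pow_rank' A h)) ?_
  let : Module (ZMod p) (Additive A) := AddCommGroup.zmodModule (n := p) fun a => h a.toMul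
  have hcard := Module.natCard_eq_pow_finrank (K := ZMod p) (V := Additive A)
  rw [Nat.card_zmod] at hcard
  have hcard' : Nat.card A = p ^ Module.finrank (ZMod p) (Additive A) := hcard
  rw [hcard']
  refine Nat.pow_le_pow_right (Nat.Prime.pos Fact.out) ?_
  classical
  let b := Module.finBasis (ZMod p) (Additive A)
  let S : Finset A := Finset.univ.image fun i => (b i).toMul
  have hS : Subgroup.closure (S : Set A) = ⊤ := by
    let H := AddSubgroup.toZModSubmodule p (Subgroup.toAddSubgroup (Subgroup.closure (S : Set A)))
    have hH : (⊤ : Submodule (ZMod p) (Additive A)) ≤ H := by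
      rw [← b.span_eq, Submodule.span_le]
      rintro _ ⟨i, rfl⟩
      exact Subgroup.subset_closure (G := A) (Finset.mem_coe.2
        (Finset.mem_image_of_mem (fun i => (b i).toMul) (Finset.mem_univ i)))
    exact eq_top_iff.2 fun a _ => hH (x := Additive.ofMul a) trivial
  exact (Group.rank_le hS).trans (Finset.card_image_le.trans (by simp))

theorem Jr_eq_Jo {E : Subgroup G} (hE : ∀ x ∈ E, x ^ p = 1) : Jr E = Jo E := by
  have hcard : ∀ B : Subgroup G, B ≤ E → IsMulCommutative B → Nat.card B = p ^ Group.rank B := by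
    intro B hB hB'
    exact card_eq_pow_rank (fun a b => Subtype.ext (setLike_mul_comm a.2 b.2))
      fun b => Subtype.ext (hE b (hB b.2))
  suffices maxRankAbelian E = maxOrderAbelian E by rw [Jr, this, Jo]
  ext A
  refine and_congr_right fun hA => and_congr_right fun hA' => forall_congr' fun B =>
    forall_congr' fun hB => forall_congr' fun hB' => ?_
  rw [hcard A hA hA', hcard B hB hB',
    Nat.pow_le_pow_iff_right (Nat.Prime.one_lt (p := p) Fact.out)]

end ZJ

theorem corollaryC {p : ℕ} [Fact p.Prime] (hp : p ≠ 2) {G : Type*} [Group G] [Finite G]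
    (hstable : ZJ.IsPStable p G) (P : Sylow p G)
    (hC : Subgroup.centralizer (ZJ.pCore p G : Set G) ≤ ZJ.pCore p G)
    (D : Subgroup G) (hD : ZJ.IsStronglyClosed (D : Set G) (P : Set G))
    (hexp : Monoid.exponent (ZJ.Omega p D) = p) :
    (ZJ.centerOf (ZJ.Jo (ZJ.Omega p D))).Normal ∧
    (ZJ.centerOf (ZJ.Jr (ZJ.Omega p D))).Normal ∧
    (ZJ.centerOf (ZJ.Je p (ZJ.Omega p D))).Normal ∧
    ZJ.Jo (ZJ.Omega p D) = ZJ.Jr (ZJ.Omega p D) ∧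
    ZJ.Jr (ZJ.Omega p D) = ZJ.Je p (ZJ.Omega p D) := by
  have hE : ∀ x ∈ ZJ.Omega p D, x ^ p = 1 := fun x hx => by
    have h := Monoid.pow_exponent_eq_one (⟨x, hx⟩ : ZJ.Omega p D)
    rw [hexp] at h
    exact congrArg Subtype.val h
  have h := ZJ.centerOf_Jo_normal hp hstable P hC (hD.omega hE)
  rw [ZJ.Jr_eq_Jo hE, ZJ.Je_eq_Jo hE]
  exact ⟨h, h, h, rfl, rfl⟩
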